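/- Let $K$ be a field. A Hom-Lie algebra over $K$ is a triple $(\mathfrak g,[\cdot,\cdot],\beta)$ consisting of a $K$-vector space $\mathfrak g$, a bilinear alternating bracket ($[x,x]=0$ for all $x$; if $\operatorname{char}K\neq 2$ this is the same as skew-symmetric) and a linear map $\beta:\mathfrak g\to\mathfrak g$ with $$[\beta(x),[y,z]]+[\beta(y),[z,x]]+[\beta(z),[x,y]]=0 .$$ It is multiplicative if $\beta([x,y])=[\beta(x),\beta(y)]$, and involutive if $\beta^2=\mathrm{id}$. A morphism of Hom-Lie algebras is a linear map preserving the brackets and commuting with the twisting maps. A Hom-Lie subalgebra is a subspace closed under the bracket and mapped into itself by $\beta$. Let $(\mathfrak g,[\cdot,\cdot],\beta)$ be an involutive multiplicative Hom-Lie algebra, $\mathfrak s\subseteq\mathfrak g$ a Hom-Lie subalgebra, and $d:\mathfrak s\to\mathfrak g$ a $\beta$-derivation, i.e. a linear map such that, for all $x,y\in\mathfrak s$, $$d(\beta(x))=\beta(d(x)),\qquad d([x,y])=[d(x),\beta(y)]+[\beta(x),d(y)].$$ The HNN-extension $\mathfrak h=\langle \mathfrak g,t : [t,x]=d(x),\ x\in\mathfrak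 s\rangle$ is the involutive multiplicative Hom-Lie algebra generated by $\mathfrak g$ and one new letter $t$, subject to the linear, bracket and twist relations of $\mathfrak g$ and to the relations $\beta_{\mathfrak h}(t)=t$ and $[t,x]_{\mathfrak h}=d(x)$ for $x\in\mathfrak s$. **Theorem.** The canonical morphism of Hom-Lie algebras $\mathfrak g\to\mathfrak h$ is injective. That is, every involutive multiplicative Hom-Lie algebra embeds into each of its HNN-extensions. -/

import Mathlib

universe u v w

/-- A Hom-Lie algebra structure on a vector space `L`: a bilinear alternating bracket and a linear
twisting map satisfying the Hom-Jacobi identity. For `β = id` this is exactly a Lie algebra, in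
every characteristic; in characteristic different from `2` alternating means skew-symmetric. -/
structure HomLieAlgebra (K : Type u) (L : Type v) [Field K] [AddCommGroup L] [Module K L] where
  bracket : L →ₗ[K] L →ₗ[K] L
  twist : L →ₗ[K] L
  bracket_self : ∀ x, bracket x x = 0
  hom_jacobi : ∀ x y z, bracket (twist x) (bracket y z) + bracket (twist y) (bracket z x) +
    bracket (twist z) (bracket x y) = 0

namespace HomLieAlgebra

variable {K : Type u} {L : Type v} {M : Type w} [Field K]
  [AddCommGroup L] [Module K L] [AddCommGroup M] [Module K M]

/-- The twisting map is an endomorphism of the bracket. -/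
def IsMultiplicative (G : HomLieAlgebra K L) : Prop :=
  ∀ x y, G.twist (G.bracket x y) = G.bracket (G.twist x) (G.twist y)

/-- The twisting map squares to the identity. -/
def IsInvolutive (G : HomLieAlgebra K L) : Prop :=
  ∀ x, G.twist (G.twist x) = x

/-- A Hom-Lie subalgebra. -/
structure Subalgebra (G : HomLieAlgebra K L) extends Submodule K L where
  bracket_mem : ∀ {x y}, x ∈ toSubmodule → y ∈ toSubmodule → G.bracket x y ∈ toSubmodule
  twist_mem : ∀ {x}, x ∈ toSubmodule → G.twist x ∈ toSubmodule

/-- A morphism of Hom-Lie algebras. -/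
structure Hom (G : HomLieAlgebra K L) (H : HomLieAlgebra K M) extends L →ₗ[K] M where
  map_bracket : ∀ x y, toLinearMap (G.bracket x y) = H.bracket (toLinearMap x) (toLinearMap y)
  map_twist : ∀ x, toLinearMap (G.twist x) = H.twist (toLinearMap x)

/-- A `β`-derivation `d : s → g` defined on a Hom-Lie subalgebra `s` of `(g, [·,·], β)`. -/
structure Derivation (G : HomLieAlgebra K L) (s : G.Subalgebra) where
  toLinearMap : s.toSubmodule →ₗ[K] L
  map_twist : ∀ x : s.toSubmodule,
    toLinearMap ⟨G.twist x, s.twist_mem x.2⟩ = G.twist (toLinearMap x)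
  map_bracket : ∀ x y : s.toSubmodule,
    toLinearMap ⟨G.bracket x y, s.bracket_mem x.2 y.2⟩ =
      G.bracket (toLinearMap x) (G.twist y) + G.bracket (G.twist x) (toLinearMap y)

/-! ### The HNN-extension `⟨g, t : [t, x] = d(x), x ∈ s⟩` -/

namespace HNN

/-- The free nonassociative algebra on the underlying set of `g` (the generators `some x`) and one
more letter `t` (the generator `none`). -/
abbrev Free (K : Type u) (L : Type v) [Field K] : Type (max u v) :=
  FreeNonUnitalNonAssocAlgebra K (Option L)

/-- The generator attached to an element of `g`. -/
noncomputable def gen (K : Type u) {L : Type v} [Field K] (x : L) : Free K L :=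
  FreeNonUnitalNonAssocAlgebra.of K (some x)

/-- The letter `t`. -/
noncomputable def letter (K : Type u) (L : Type v) [Field K] : Free K L :=
  FreeNonUnitalNonAssocAlgebra.of K none

/-- The multiplicative linear map with `x ↦ β x` for `x ∈ g` and `t ↦ t`. -/
noncomputable def freeTwist (G : HomLieAlgebra K L) : Free K L →ₙₐ[K] Free K L :=
  FreeNonUnitalNonAssocAlgebra.lift K
    (fun i => i.elim (letter K L) (fun x => gen K (G.twist x)))

/-- The relators of the presentation, the product of `Free K L` being read as the bracket. -/
inductive Relator (G : HomLieAlgebra K L) (s : G.Subalgebra) (d : G.Derivation s) :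
    Free K L → Prop
  | gen_add (x y : L) : Relator G s d (gen K (x + y) - (gen K x + gen K y))
  | gen_smul (c : K) (x : L) : Relator G s d (gen K (c • x) - c • gen K x)
  | gen_bracket (x y : L) : Relator G s d (gen K (G.bracket x y) - gen K x * gen K y)
  | hnn (x : s.toSubmodule) :
      Relator G s d (letter K L * gen K (x : L) - gen K (d.toLinearMap x))
  | self (a : Free K L) : Relator G s d (a * a)
  | jacobi (a b c : Free K L) : Relator G s d
      (freeTwist G a * (b * c) + freeTwist G b * (c * a) + freeTwist G c * (a * b))
  | involutive (a : Free K L) : Relator G s d (freeTwist G (freeTwist G a) - a)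

/-- A Hom-ideal of the free algebra: a two-sided ideal stable under the twisting map. -/
def IsHomIdeal (G : HomLieAlgebra K L) (I : Submodule K (Free K L)) : Prop :=
  ∀ a ∈ I, freeTwist G a ∈ I ∧ ∀ b, a * b ∈ I ∧ b * a ∈ I

/-- The Hom-ideal generated by the relators. -/
noncomputable def ideal (G : HomLieAlgebra K L) (s : G.Subalgebra) (d : G.Derivation s) :
    Submodule K (Free K L) :=
  sInf {I | IsHomIdeal G I ∧ ∀ a, Relator G s d a → a ∈ I}

variable (G : HomLieAlgebra K L) (s : G.Subalgebra) (d : G.Derivation s)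

theorem isHomIdeal_ideal : IsHomIdeal G (ideal G s d) := by
  intro a ha
  simp only [ideal, Submodule.mem_sInf] at ha ⊢
  exact ⟨fun I hI => (hI.1 a (ha I hI)).1, fun b =>
    ⟨fun I hI => ((hI.1 a (ha I hI)).2 b).1, fun I hI => ((hI.1 a (ha I hI)).2 b).2⟩⟩

theorem relator_mem {a : Free K L} (ha : Relator G s d a) : a ∈ ideal G s d := by
  simp only [ideal, Submodule.mem_sInf]
  exact fun I hI => hI.2 a ha

/-- The underlying vector space of the HNN-extension. -/
abbrev Carrier : Type (max u v) := Free K L ⧸ ideal G s d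

/-- The bracket of the HNN-extension, induced by the product of the free algebra. -/
noncomputable def bracket : Carrier G s d →ₗ[K] Carrier G s d →ₗ[K] Carrier G s d :=
  (ideal G s d).liftQ
    (((ideal G s d).liftQ ((LinearMap.mul K (Free K L)).compr₂ (ideal G s d).mkQ).flip (by
      intro a ha
      refine LinearMap.ext fun b => ?_
      exact (Submodule.Quotient.mk_eq_zero _).2
        (((isHomIdeal_ideal G s d) a ha).2 b).2)).flip) (by
    intro a ha
    refine LinearMap.ext fun b => ?_
    obtain ⟨b, rfl⟩ := Submodule.mkQ_surjective _ b
    exact (Submodule.Quotient.mk_eq_zero _).2 (((isHomIdeal_ideal G s d) a ha).2 b).1)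

/-- The twisting map of the HNN-extension. -/
noncomputable def twist : Carrier G s d →ₗ[K] Carrier G s d :=
  (ideal G s d).mapQ (ideal G s d) (freeTwist G : Free K L →ₗ[K] Free K L)
    (fun a ha => ((isHomIdeal_ideal G s d) a ha).1)

theorem bracket_mk (a b : Free K L) :
    bracket G s d ((ideal G s d).mkQ a) ((ideal G s d).mkQ b) = (ideal G s d).mkQ (a * b) := rfl

theorem twist_mk (a : Free K L) :
    twist G s d ((ideal G s d).mkQ a) = (ideal G s d).mkQ (freeTwist G a) := rfl

set_option linter.unusedSectionVars false in
/-- Linear maps out of the free algebra that turn products into a given bilinear operation. -/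
theorem free_lift (B : M →ₗ[K] M →ₗ[K] M) (f : Option L → M) :
    ∃! F : Free K L →ₗ[K] M, (∀ a b, F (a * b) = B (F a) (F b)) ∧
      ∀ i, F (FreeNonUnitalNonAssocAlgebra.of K i) = f i := by
  let _ : NonUnitalNonAssocSemiring M :=
    { (inferInstance : AddCommMonoid M) with
      mul := fun x y => B x y
      left_distrib := fun x y z => (B x).map_add y z
      right_distrib := fun x y z => by
        change B (x + y) z = B x z + B y z
        simp
      zero_mul := fun x => by
        change B 0 x = 0
        simp
      mul_zero := fun x => (B x).map_zero }
  have : IsScalarTower K M M := ⟨fun c x y => by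
    change B (c • x) y = c • B x y
    simp⟩
  have : SMulCommClass K M M := ⟨fun c x y => by
    change c • B x y = B x (c • y)
    simp⟩
  refine ⟨(FreeNonUnitalNonAssocAlgebra.lift K f : Free K L →ₙₐ[K] M), ⟨fun a b => ?_,
    fun i => FreeNonUnitalNonAssocAlgebra.lift_of_apply K f i⟩, ?_⟩
  · exact map_mul (FreeNonUnitalNonAssocAlgebra.lift K f) a b
  · rintro F ⟨hF, hf⟩
    let F' : Free K L →ₙₐ[K] M :=
      { toFun := F
        map_smul' := F.map_smul
        map_zero' := F.map_zero
        map_add' := F.map_add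
        map_mul' := hF }
    have h : F' = FreeNonUnitalNonAssocAlgebra.lift K f :=
      (FreeNonUnitalNonAssocAlgebra.lift_unique K f F').1 (funext hf)
    refine LinearMap.ext fun a => ?_
    exact DFunLike.congr_fun h a

end HNN

variable (G : HomLieAlgebra K L) (s : G.Subalgebra) (d : G.Derivation s)

/-- The HNN-extension `h = ⟨g, t : [t, x] = d(x), x ∈ s⟩` as a Hom-Lie algebra. -/
noncomputable def HNNExtension : HomLieAlgebra K (HNN.Carrier G s d) where
  bracket := HNN.bracket G s d
  twist := HNN.twist G s d
  bracket_self := by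
    intro x
    obtain ⟨a, rfl⟩ := Submodule.mkQ_surjective _ x
    exact (Submodule.Quotient.mk_eq_zero _).2 (HNN.relator_mem G s d (.self a))
  hom_jacobi := by
    intro x y z
    obtain ⟨a, rfl⟩ := Submodule.mkQ_surjective _ x
    obtain ⟨b, rfl⟩ := Submodule.mkQ_surjective _ y
    obtain ⟨c, rfl⟩ := Submodule.mkQ_surjective _ z
    exact (Submodule.Quotient.mk_eq_zero _).2 (HNN.relator_mem G s d (.jacobi a b c))

namespace HNNExtension

theorem isMultiplicative : (HNNExtension G s d).IsMultiplicative := by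
  intro x y
  obtain ⟨a, rfl⟩ := Submodule.mkQ_surjective _ x
  obtain ⟨b, rfl⟩ := Submodule.mkQ_surjective _ y
  change (HNN.ideal G s d).mkQ (HNN.freeTwist G (a * b)) =
    (HNN.ideal G s d).mkQ (HNN.freeTwist G a * HNN.freeTwist G b)
  rw [map_mul]

theorem isInvolutive : (HNNExtension G s d).IsInvolutive := by
  intro x
  obtain ⟨a, rfl⟩ := Submodule.mkQ_surjective _ x
  exact (Submodule.Quotient.eq _).2 (HNN.relator_mem G s d (.involutive a))

/-- The stable letter `t`. -/
noncomputable def t : HNN.Carrier G s d := (HNN.ideal G s d).mkQ (HNN.letter K L)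

/-- The canonical morphism of Hom-Lie algebras from `g` to its HNN-extension. -/
noncomputable def of : Hom G (HNNExtension G s d) where
  toFun x := (HNN.ideal G s d).mkQ (HNN.gen K x)
  map_add' x y := (Submodule.Quotient.eq _).2 (HNN.relator_mem G s d (.gen_add x y))
  map_smul' c x := (Submodule.Quotient.eq _).2 (HNN.relator_mem G s d (.gen_smul c x))
  map_bracket x y := (Submodule.Quotient.eq _).2 (HNN.relator_mem G s d (.gen_bracket x y))
  map_twist x := by
    change (HNN.ideal G s d).mkQ (HNN.gen K (G.twist x)) =
      (HNN.ideal G s d).mkQ (HNN.freeTwist G (HNN.gen K x))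
    simp [HNN.freeTwist, HNN.gen]

theorem twist_t : (HNNExtension G s d).twist (t G s d) = t G s d := by
  change (HNN.ideal G s d).mkQ (HNN.freeTwist G (HNN.letter K L)) = _
  simp [HNN.freeTwist, HNN.letter, t]

theorem bracket_t (x : s.toSubmodule) :
    (HNNExtension G s d).bracket (t G s d) ((of G s d).toLinearMap x) =
      (of G s d).toLinearMap (d.toLinearMap x) :=
  (Submodule.Quotient.eq _).2 (HNN.relator_mem G s d (.hnn x))

/-- The universal property of the presentation among involutive multiplicative Hom-Lie algebras. -/
theorem existsUnique_lift (H : HomLieAlgebra K M) (hm : H.IsMultiplicative) (hi : H.IsInvolutive)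
    (f : Hom G H) (τ : M) (hτ : H.twist τ = τ)
    (hd : ∀ x : s.toSubmodule,
      H.bracket τ (f.toLinearMap x) = f.toLinearMap (d.toLinearMap x)) :
    ∃! F : Hom (HNNExtension G s d) H,
      (∀ x, F.toLinearMap ((of G s d).toLinearMap x) = f.toLinearMap x) ∧
        F.toLinearMap (t G s d) = τ := by
  obtain ⟨F, ⟨hmul, hgen⟩, huniq⟩ := HNN.free_lift (L := L) H.bracket
    (fun i => i.elim τ (fun x => f.toLinearMap x))
  have hg : ∀ x : L, F (HNN.gen K x) = f.toLinearMap x := fun x => hgen (some x)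
  have ht : F (HNN.letter K L) = τ := hgen none
  have htw : ∀ a, F (HNN.freeTwist G a) = H.twist (F a) := by
    obtain ⟨E, -, hE⟩ := HNN.free_lift (L := L) H.bracket
      (fun i => i.elim τ (fun x => H.twist (f.toLinearMap x)))
    have h1 : F ∘ₗ (HNN.freeTwist G : HNN.Free K L →ₗ[K] HNN.Free K L) = E := by
      refine hE _ ⟨fun a b => ?_, fun i => ?_⟩
      · change F (HNN.freeTwist G (a * b)) = H.bracket (F (HNN.freeTwist G a)) _
        rw [map_mul, hmul]
        rfl
      · change F (HNN.freeTwist G (FreeNonUnitalNonAssocAlgebra.of K i)) = _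
        rw [HNN.freeTwist, FreeNonUnitalNonAssocAlgebra.lift_of_apply]
        cases i with
        | none => exact ht
        | some x => exact (hg _).trans (f.map_twist x)
    have h2 : H.twist ∘ₗ F = E := by
      refine hE _ ⟨fun a b => ?_, fun i => ?_⟩
      · simp [hmul, hm _ _]
      · rw [LinearMap.comp_apply, hgen]
        cases i with
        | none => exact hτ
        | some x => rfl
    exact fun a => LinearMap.congr_fun (h1.trans h2.symm) a
  have hker : HNN.ideal G s d ≤ LinearMap.ker F := by
    refine sInf_le ⟨fun a ha => ?_, fun a ha => ?_⟩
    · rw [LinearMap.mem_ker] at ha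
      refine ⟨?_, fun b => ⟨?_, ?_⟩⟩ <;> rw [LinearMap.mem_ker]
      · rw [htw, ha, map_zero]
      · rw [hmul, ha, map_zero, LinearMap.zero_apply]
      · rw [hmul, ha, map_zero]
    · rw [LinearMap.mem_ker]
      cases ha with
      | gen_add x y => simp [hg]
      | gen_smul c x => simp [hg]
      | gen_bracket x y => simp [hg, hmul, f.map_bracket]
      | hnn x => simp [hg, ht, hmul, hd]
      | self a => rw [hmul, H.bracket_self]
      | jacobi a b c => simp only [map_add, hmul, htw, H.hom_jacobi]
      | involutive a => rw [map_sub, htw, htw, hi, sub_self]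
  refine ⟨{ toLinearMap := (HNN.ideal G s d).liftQ F hker
            map_bracket := ?_
            map_twist := ?_ }, ⟨hg, ht⟩, ?_⟩
  · intro x y
    obtain ⟨a, rfl⟩ := Submodule.mkQ_surjective _ x
    obtain ⟨b, rfl⟩ := Submodule.mkQ_surjective _ y
    exact hmul a b
  · intro x
    obtain ⟨a, rfl⟩ := Submodule.mkQ_surjective _ x
    exact htw a
  · rintro E ⟨hE, hEt⟩
    have h : E.toLinearMap ∘ₗ (HNN.ideal G s d).mkQ = F := by
      refine huniq _ ⟨fun a b => ?_, fun i => ?_⟩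
      · exact E.map_bracket ((HNN.ideal G s d).mkQ a) ((HNN.ideal G s d).mkQ b)
      · cases i with
        | none => exact hEt
        | some x => exact hE x
    have h' : E.toLinearMap = (HNN.ideal G s d).liftQ F hker := by
      refine LinearMap.ext fun x => ?_
      obtain ⟨a, rfl⟩ := Submodule.mkQ_surjective _ x
      exact LinearMap.congr_fun h a
    cases E
    subst h'
    rfl

end HNNExtension

end HomLieAlgebra

/-! ### Confluence of rewriting systems `a b → b a + c(a, b)` -/

namespace SwapRewriting

variable {K : Type u} {X : Type v} {M : Type w} [Field K] [AddCommGroup M] [Module K M]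

/-! By the universal property of the presentation, it suffices to embed `G` into some involutive
multiplicative Hom-Lie algebra in which `d` is the bracket with an element fixed by the twist
(`exists_embedding_inner`).

Since `β` is an involutive automorphism, `β[x, y]` is an ordinary Lie bracket on the same space, and
`β ∘ d` is an ordinary derivation from `s`. Given a faithful representation `ρ` of this Lie algebra
and an endomorphism `T` with `[T, ρ x] = ρ (β (d x))` on `s`, the map `x ↦ (ρ x, ρ (β x))` into `End
V × End V` turns `β` into the interchange of factors, which fixes `(T, T)`. Twisting the
componentwise bracket by this interchange gives the required Hom-Lie algebra.

The pair `ρ`, `T` comes from a Poincaré–Birkhoff–Witt argument (`exists_faithful_representation`).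
The letters are a basis of the Lie algebra and `t`; a descent `a b` is rewritten as `b a` plus the
prescribed commutator. All overlaps resolve, by the Jacobi identity or by the Leibniz rule, so
values prescribed on irreducible words extend to functions on all words that respect the rules
(`exists_compatible`). Such functions are the linear maps out of the presented associative algebra;
translation represents this algebra on them, and a function that recovers each basis vector from its
letter makes `ρ` faithful. -/

/-- The linear extension of `x ↦ N (p x q)`. -/
noncomputable def insert (K : Type u) [Field K] [Module K M] (N : List X → M) (p q : List X) :
    (X →₀ K) →ₗ[K] M :=
  Finsupp.linearCombination K fun x => N (p ++ x :: q)

/-- The bilinear extension of `(x, y) ↦ N (p x y q)`. -/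
noncomputable def insert₂ (K : Type u) [Field K] [Module K M] (N : List X → M) (p q : List X) :
    (X →₀ K) →ₗ[K] (X →₀ K) →ₗ[K] M :=
  Finsupp.linearCombination K fun x => insert K N (p ++ [x]) q

theorem insert_single (N : List X → M) (p q : List X) (x : X) :
    insert K N p q (Finsupp.single x 1) = N (p ++ x :: q) := by
  simp [insert]

theorem insert₂_single_left (N : List X → M) (p q : List X) (x : X) (v : X →₀ K) :
    insert₂ K N p q (Finsupp.single x 1) v = insert K N (p ++ [x]) q v := by
  simp [insert₂]

theorem insert₂_single_right (N : List X → M) (p q : List X) (x : X) (v : X →₀ K) :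
    insert₂ K N p q v (Finsupp.single x 1) = insert K N p (x :: q) v := by
  have h : (insert₂ K N p q).flip (Finsupp.single x 1) = insert K N p (x :: q) := by
    ext y
    simp [insert₂, insert]
  exact LinearMap.congr_fun h v

variable (R : X → X → Prop) (c : X → X → X →₀ K)

/-- `N` is compatible with every application of a rule to the word `W`. -/
def CompatibleAt (N : List X → M) (W : List X) : Prop :=
  ∀ p a b q, R a b → W = p ++ a :: b :: q →
    N W = N (p ++ b :: a :: q) + insert K N p q (c a b)

/-- No rule applies to the word `W`. -/
def IsIrreducible (W : List X) : Prop :=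
  ∀ p a b q, R a b → W ≠ p ++ a :: b :: q

/-- The overlaps of two rules are resolved by every pair of a bilinear and a linear map that
satisfies the rules. -/
def ResolvesOverlaps (M : Type w) [AddCommGroup M] [Module K M] : Prop :=
  ∀ (B : (X →₀ K) →ₗ[K] (X →₀ K) →ₗ[K] M) (l : (X →₀ K) →ₗ[K] M),
    (∀ x y, R x y → B (.single x 1) (.single y 1) - B (.single y 1) (.single x 1) = l (c x y)) →
    ∀ x y z, R x y → R y z →
      B (c x y) (.single z 1) - B (.single z 1) (c x y) +
      (B (c y z) (.single x 1) - B (.single x 1) (c y z)) -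
      (B (c x z) (.single y 1) - B (.single y 1) (c x z)) = 0

/-- The tails may differ because the first changed letter already decides; this covers several
successive swaps at once. -/
theorem shortlex_of_rel {a b : X} (h : R a b) (p : List X) {q r : List X}
    (hqr : q.length = r.length) :
    List.Shortlex (fun x y => R y x) (p ++ b :: q) (p ++ a :: r) := by
  refine List.Shortlex.of_lex (by simp [hqr]) ?_
  induction p with
  | nil => exact .rel h
  | cons x p ih => exact .cons ih

theorem shortlex_swap {a b : X} (h : R a b) (p q : List X) :
    List.Shortlex (fun x y => R y x) (p ++ b :: a :: q) (p ++ a :: b :: q) :=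
  shortlex_of_rel R h p rfl

theorem shortlex_insert (a b x : X) (p q : List X) :
    List.Shortlex (fun x y => R y x) (p ++ x :: q) (p ++ a :: b :: q) :=
  List.Shortlex.of_length_lt (by simp)

/-- A function on words obtained by rewriting at one chosen place of each reducible word. -/
theorem exists_reduction (hR : WellFounded fun x y => R y x) (g : List X → M) :
    ∃ N : List X → M, (∀ W, IsIrreducible R W → N W = g W) ∧
      ∀ W, ¬ IsIrreducible R W → ∃ p a b q, R a b ∧ W = p ++ a :: b :: q ∧
        N W = N (p ++ b :: a :: q) + insert K N p q (c a b) := by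
  classical
  have hwf : WellFounded (List.Shortlex fun x y => R y x) := List.Shortlex.wf hR
  have key : ∀ W, ¬ IsIrreducible R W →
      ∃ t : List X × X × X × List X, R t.2.1 t.2.2.1 ∧ W = t.1 ++ t.2.1 :: t.2.2.1 :: t.2.2.2 := by
    intro W hW
    simp only [IsIrreducible, not_forall, not_not] at hW
    obtain ⟨p, a, b, q, h, e⟩ := hW
    exact ⟨(p, a, b, q), h, e⟩
  choose t ht hW using key
  let F (W : List X) (rec : ∀ W', List.Shortlex (fun x y => R y x) W' W → M) : M :=
    if h : IsIrreducible R W then g W else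
      rec ((t W h).1 ++ (t W h).2.2.1 :: (t W h).2.1 :: (t W h).2.2.2)
        (by simpa only [← hW W h] using shortlex_swap R (ht W h) (t W h).1 (t W h).2.2.2) +
      Finsupp.linearCombination K (fun x => rec ((t W h).1 ++ x :: (t W h).2.2.2)
        (by simpa only [← hW W h] using
          shortlex_insert R (t W h).2.1 (t W h).2.2.1 x (t W h).1 (t W h).2.2.2))
        (c (t W h).2.1 (t W h).2.2.1)
  refine ⟨hwf.fix F, fun W h => ?_, fun W h => ⟨_, _, _, _, ht W h, hW W h, ?_⟩⟩
  · rw [hwf.fix_eq]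
    exact dif_pos h
  · rw [hwf.fix_eq]
    exact dif_neg h

/-- Both one-step reductions of `x y z` can be continued to `z y x`, transitivity supplying the rule
for `x z`. The accumulated corrections differ by the Jacobi-type expression in `ResolvesOverlaps`.
-/
theorem compatibleAt_of_overlap (N : List X → M) (htr : ∀ x y z, R x y → R y z → R x z)
    (hov : ResolvesOverlaps R c M) {p q : List X} {x y z : X} (hxy : R x y) (hyz : R y z)
    (ih : ∀ W, List.Shortlex (fun x y => R y x) W (p ++ x :: y :: z :: q) →
      CompatibleAt R c N W) :
    N (p ++ y :: x :: z :: q) + insert K N p (z :: q) (c x y) =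
      N (p ++ x :: z :: y :: q) + insert K N (p ++ [x]) q (c y z) := by
  have hxz := htr _ _ _ hxy hyz
  have l1 : List.Shortlex (fun x y => R y x) (p ++ y :: x :: z :: q) (p ++ x :: y :: z :: q) :=
    shortlex_swap R hxy p (z :: q)
  have l2 : List.Shortlex (fun x y => R y x) (p ++ x :: z :: y :: q) (p ++ x :: y :: z :: q) := by
    simpa using shortlex_swap R hyz (p ++ [x]) q
  have e1 := ih _ l1 (p ++ [y]) x z q hxz (by simp)
  have e2 := ih _ l2 p x z (y :: q) hxz rfl
  have e3 := ih _ (shortlex_of_rel R hxy p (by simp)) p y z (x :: q) hyz rfl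
  have e4 := ih (p ++ z :: x :: y :: q) (shortlex_of_rel R hxz p (by simp)) (p ++ [z]) x y q hxy
    (by simp)
  -- Words with two letters between `p` and `q` are shorter than the given one, so the induction
  -- hypothesis gives the rules for this bilinear map.
  have h := hov (insert₂ K N p q) (insert K N p q) (fun a b hab => by
    have := ih (p ++ a :: b :: q) (List.Shortlex.of_length_lt (by simp)) p a b q hab rfl
    rw [insert₂_single_left, insert₂_single_left, insert_single, insert_single]
    simp only [List.append_assoc, List.singleton_append]
    rw [this, add_sub_cancel_left]) x y z hxy hyz
  simp only [insert₂_single_left, insert₂_single_right] at h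
  simp only [List.append_assoc, List.singleton_append] at e1 e2 e3 e4
  rw [e1, e2, e3, e4]
  rw [← sub_eq_zero]
  rw [← h]
  abel

/-- Disjoint rewritings commute: performing the second one in either order produces the same four
terms, the double sum being the one with both places replaced by corrections. -/
theorem compatibleAt_of_disjoint (N : List X → M) {p q r : List X} {x y z t : X}
    (hxy : R x y) (hzt : R z t)
    (ih : ∀ W, List.Shortlex (fun x y => R y x) W (p ++ x :: y :: (q ++ z :: t :: r)) →
      CompatibleAt R c N W) :
    N (p ++ y :: x :: (q ++ z :: t :: r)) + insert K N p (q ++ z :: t :: r) (c x y) =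
      N (p ++ x :: y :: (q ++ t :: z :: r)) + insert K N (p ++ x :: y :: q) r (c z t) := by
  have e1 := ih _ (shortlex_swap R hxy p _) (p ++ y :: x :: q) z t r hzt (by simp)
  have e2 := ih (p ++ x :: y :: (q ++ t :: z :: r))
    (by simpa using shortlex_swap R hzt (p ++ x :: y :: q) r) p x y _ hxy rfl
  have e3 : insert K N p (q ++ z :: t :: r) (c x y) =
      insert K N p (q ++ t :: z :: r) (c x y) +
        (c x y).sum fun a k => (c z t).sum fun b l => (k * l) • N (p ++ a :: (q ++ b :: r)) := by
    simp only [insert, Finsupp.linearCombination_apply]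
    rw [← Finsupp.sum_add]
    refine Finsupp.sum_congr fun a _ => ?_
    rw [ih _ (List.Shortlex.of_length_lt (by simp)) (p ++ a :: q) z t r hzt (by simp), smul_add]
    simp [insert, Finsupp.linearCombination_apply, Finsupp.smul_sum, mul_smul]
  have e4 : insert K N (p ++ x :: y :: q) r (c z t) =
      insert K N (p ++ y :: x :: q) r (c z t) +
        (c x y).sum fun a k => (c z t).sum fun b l => (k * l) • N (p ++ a :: (q ++ b :: r)) := by
    rw [Finsupp.sum_comm]
    simp only [insert, Finsupp.linearCombination_apply]
    rw [← Finsupp.sum_add]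
    refine Finsupp.sum_congr fun b _ => ?_
    rw [ih _ (List.Shortlex.of_length_lt (by simp)) p x y (q ++ b :: r) hxy (by simp), smul_add]
    simp [insert, Finsupp.linearCombination_apply, Finsupp.smul_sum, smul_smul, mul_comm]
  rw [e1, e2, e3, e4]
  simp only [List.append_assoc, List.cons_append]
  abel

/-- Functions on irreducible words extend to functions on all words compatible with the rules. -/
theorem exists_compatible (hR : WellFounded fun x y => R y x)
    (htr : ∀ x y z, R x y → R y z → R x z) (hov : ResolvesOverlaps R c M) (g : List X → M) :
    ∃ N : List X → M, (∀ W, IsIrreducible R W → N W = g W) ∧ ∀ W, CompatibleAt R c N W := by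
  obtain ⟨N, hN, hred⟩ := exists_reduction R c hR g
  have hwf : WellFounded (List.Shortlex fun x y => R y x) := List.Shortlex.wf hR
  refine ⟨N, hN, fun W => ?_⟩
  induction W using hwf.induction with
  | _ W ih =>
  intro p a b q hab hW
  obtain ⟨p', a', b', q', hab', hW', e⟩ := hred W fun h => h p a b q hab hW
  rw [e]
  clear e hN hred
  subst hW
  -- `m` is the offset between the two places: length 0 is the same rule, length 1 an overlap in one
  -- letter, and anything longer a disjoint pair.
  rcases List.append_eq_append_iff.1 hW' with ⟨m, rfl, hm⟩ | ⟨m, rfl, hm⟩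
  · rcases m with _ | ⟨x, _ | ⟨y, m⟩⟩
    · simp only [List.nil_append, List.cons.injEq] at hm
      obtain ⟨rfl, rfl, rfl⟩ := hm
      simp
    · simp only [List.cons_append, List.nil_append, List.cons.injEq] at hm
      obtain ⟨rfl, rfl, rfl⟩ := hm
      simpa using (compatibleAt_of_overlap R c N htr hov hab hab' ih).symm
    · simp only [List.cons_append, List.cons.injEq] at hm
      obtain ⟨rfl, rfl, rfl⟩ := hm
      simpa using (compatibleAt_of_disjoint R c N hab hab' ih).symm
  · rcases m with _ | ⟨x, _ | ⟨y, m⟩⟩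
    · simp only [List.nil_append, List.cons.injEq] at hm
      obtain ⟨rfl, rfl, rfl⟩ := hm
      simp
    · simp only [List.cons_append, List.nil_append, List.cons.injEq] at hm
      obtain ⟨rfl, rfl, rfl⟩ := hm
      simp only [List.append_assoc, List.cons_append, List.nil_append] at ih
      simpa using compatibleAt_of_overlap R c N htr hov hab' hab ih
    · simp only [List.cons_append, List.cons.injEq] at hm
      obtain ⟨rfl, rfl, rfl⟩ := hm
      simp only [List.append_assoc, List.cons_append] at ih
      simpa using compatibleAt_of_disjoint R c N hab' hab ih

/-! ### The translation action on compatible functions -/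

/-- The functions on words compatible with every rule. -/
def compatible : Submodule K (List X → M) where
  carrier := {N | ∀ p a b q, R a b →
    N (p ++ a :: b :: q) = N (p ++ b :: a :: q) + insert K N p q (c a b)}
  zero_mem' p a b q _ := by simp [insert, Finsupp.linearCombination_apply]
  add_mem' {N N'} h h' p a b q hab := by
    have e : insert K (N + N') p q (c a b) = insert K N p q (c a b) + insert K N' p q (c a b) := by
      simp [insert, Finsupp.linearCombination_apply, smul_add, Finsupp.sum_add]
    rw [e, Pi.add_apply, h p a b q hab, h' p a b q hab, Pi.add_apply]
    abel
  smul_mem' k N h p a b q hab := by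
    have e : insert K (k • N) p q (c a b) = k • insert K N p q (c a b) := by
      simp [insert, Finsupp.linearCombination_apply, Finsupp.smul_sum, smul_smul, mul_comm]
    rw [e, Pi.smul_apply, h p a b q hab, Pi.smul_apply, smul_add]

/-- The action of a letter on compatible functions by translation. -/
def shift (x : X) : Module.End K (compatible R c (M := M)) where
  toFun N := ⟨fun p => N.1 (p ++ [x]), fun p a b q hab => by
    have h := N.2 p a b (q ++ [x]) hab
    simp only [insert, List.append_assoc, List.cons_append] at h ⊢
    exact h⟩
  map_add' _ _ := rfl
  map_smul' _ _ := rfl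

/-- The linear extension of `shift`. -/
noncomputable def shiftHom : (X →₀ K) →ₗ[K] Module.End K (compatible R c (M := M)) :=
  Finsupp.linearCombination K (shift R c)

theorem shiftHom_single (x : X) :
    shiftHom R c (M := M) (Finsupp.single x 1) = shift R c x := by
  simp [shiftHom]

theorem shiftHom_apply (v : X →₀ K) (N : compatible R c (M := M)) (p : List X) :
    (shiftHom R c v N).1 p = insert K N.1 p [] v := by
  induction v using Finsupp.induction_linear with
  | zero => simp
  | add v w hv hw => simpa using congrArg₂ (· + ·) hv hw
  | single x k =>
    simp only [shiftHom, insert, Finsupp.linearCombination_single]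
    rfl

theorem shift_commutator {a b : X} (hab : R a b) :
    shift R c (M := M) a * shift R c b - shift R c b * shift R c a = shiftHom R c (c a b) := by
  refine LinearMap.ext fun N => Subtype.ext <| funext fun p => ?_
  rw [shiftHom_apply]
  have h := N.2 p a b [] hab
  have e : ((shift R c (M := M) a * shift R c b - shift R c b * shift R c a :
      Module.End K (compatible R c (M := M))) N).1 p =
      N.1 ((p ++ [a]) ++ [b]) - N.1 ((p ++ [b]) ++ [a]) := rfl
  rw [e, List.append_assoc, List.append_assoc]
  simp only [List.singleton_append]
  rw [h, add_sub_cancel_left]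

end SwapRewriting

/-! ### Adjoining an element that induces a derivation of a subalgebra -/

attribute [local instance 100] LieRing.ofAssociativeRing

namespace LieHNN

open SwapRewriting

variable {K : Type u} {L : Type v} {I : Type v} {M : Type w} [Field K] [LieRing L] [LieAlgebra K L]
  [AddCommGroup M] [Module K M]

/-- The pairs of letters that are interchanged, the letter `none` being the stable one. -/
def Rule (r : I → I → Prop) (S : Set I) : Option I → Option I → Prop
  | some i, some j => r j i
  | none, some j => j ∈ S
  | _, none => False

theorem Rule.wellFounded {r : I → I → Prop} (hr : WellFounded r) (S : Set I) :
    WellFounded fun x y => Rule r S y x := by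
  have h : ∀ i, Acc (fun x y => Rule r S y x) (some i) := fun i => by
    induction i using hr.induction with
    | _ i ih =>
    refine ⟨_, fun x hx => ?_⟩
    cases x with
    | none => exact hx.elim
    | some j => exact ih j hx
  refine ⟨fun x => ?_⟩
  cases x with
  | some i => exact h i
  | none =>
    refine ⟨_, fun y hy => ?_⟩
    cases y with
    | none => exact hy.elim
    | some j => exact h j

/-- This is where `S` must be an initial segment: `t` passes every letter below one that it passes.
-/
theorem Rule.trans {r : I → I → Prop} (hr : ∀ i j k, r i j → r j k → r i k) {S : Set I}
    (hS : ∀ i j, r i j → j ∈ S → i ∈ S) (x y z : Option I)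
    (hxy : Rule r S x y) (hyz : Rule r S y z) : Rule r S x z := by
  rcases z with _ | k
  · exact (by cases y <;> exact hyz : False).elim
  rcases y with _ | j
  · exact (by cases x <;> exact hxy : False).elim
  rcases x with _ | i
  · exact hS _ _ hyz hxy
  · exact hr _ _ _ hyz hxy

variable (b : Module.Basis I K L) (D : L →ₗ[K] L)

/-- Elements of the Lie algebra as combinations of letters. -/
noncomputable def letters : L →ₗ[K] Option I →₀ K :=
  Finsupp.lmapDomain K K some ∘ₗ b.repr.toLinearMap

theorem letters_basis (i : I) : letters b (b i) = Finsupp.single (some i) 1 := by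
  simp [letters]

/-- The commutators of letters. -/
noncomputable def commutator : Option I → Option I → Option I →₀ K
  | some i, some j => letters b ⁅b i, b j⁆
  | none, some j => letters b (D (b j))
  | _, none => 0

variable {b D} {r : I → I → Prop} {S : Set I}
  {B : (Option I →₀ K) →ₗ[K] (Option I →₀ K) →ₗ[K] M} {l : (Option I →₀ K) →ₗ[K] M}

/-- The rules only concern descending pairs of basis letters; antisymmetry and trichotomy give all
pairs, and bilinearity all vectors. -/
theorem commutator_letters (hr : ∀ i j, r i j ∨ i = j ∨ r j i)
    (hB : ∀ x y, Rule r S x y →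
      B (.single x 1) (.single y 1) - B (.single y 1) (.single x 1) = l (commutator b D x y))
    (u v : L) :
    B (letters b u) (letters b v) - B (letters b v) (letters b u) = l (letters b ⁅u, v⁆) := by
  have h : (B.compl₁₂ (letters b) (letters b)) - (B.compl₁₂ (letters b) (letters b)).flip =
      (LieModule.toEnd K L L : L →ₗ[K] Module.End K L).compr₂ (l ∘ₗ letters b) := by
    refine LinearMap.ext_basis b b fun i j => ?_
    simp only [LinearMap.sub_apply, LinearMap.compl₁₂_apply, LinearMap.flip_apply,
      letters_basis, LinearMap.compr₂_apply]
    change _ = l (letters b ⁅b i, b j⁆)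
    rcases hr i j with hij | rfl | hij
    · have := hB (some j) (some i) hij
      rw [← neg_sub, this, ← lie_skew, map_neg, map_neg]
      rfl
    · simp
    · exact hB (some i) (some j) hij
  exact LinearMap.congr_fun₂ h u v

theorem commutator_stable
    (hB : ∀ x y, Rule r S x y →
      B (.single x 1) (.single y 1) - B (.single y 1) (.single x 1) = l (commutator b D x y))
    {u : L} (hu : u ∈ Submodule.span K (b '' S)) :
    B (.single none 1) (letters b u) - B (letters b u) (.single none 1) =
      l (letters b (D u)) := by
  induction hu using Submodule.span_induction with
  | mem x hx =>
    obtain ⟨i, hi, rfl⟩ := hx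
    rw [letters_basis]
    exact hB none (some i) hi
  | zero => simp
  | add x y _ _ hx hy =>
    simp only [map_add, LinearMap.add_apply, ← hx, ← hy]
    abel
  | smul k x _ hx => simp only [map_smul, LinearMap.smul_apply, ← hx, smul_sub]

/-- The stable letter can only come first in an overlap. If it does, the condition is the Leibniz
rule for `D` on the span of `S`; otherwise it is the Jacobi identity. -/
theorem resolvesOverlaps (hr : ∀ i j, r i j ∨ i = j ∨ r j i)
    (hS : ∀ u ∈ Submodule.span K (b '' S), ∀ v ∈ Submodule.span K (b '' S),
      ⁅u, v⁆ ∈ Submodule.span K (b '' S))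
    (hD : ∀ u ∈ Submodule.span K (b '' S), ∀ v ∈ Submodule.span K (b '' S),
      D ⁅u, v⁆ = ⁅D u, v⁆ + ⁅u, D v⁆)
    (hlow : ∀ i j, r i j → j ∈ S → i ∈ S) :
    ResolvesOverlaps (Rule r S) (commutator b D) M := by
  intro B l hB x y z hxy hyz
  have h1 := commutator_letters hr hB
  rcases z with _ | k
  · exact (by cases y <;> exact hyz : False).elim
  rcases y with _ | j
  · exact (by cases x <;> exact hxy : False).elim
  rcases x with _ | i
  · have hj : b j ∈ Submodule.span K (b '' S) := Submodule.subset_span ⟨j, hxy, rfl⟩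
    have hk : b k ∈ Submodule.span K (b '' S) :=
      Submodule.subset_span ⟨k, hlow k j hyz hxy, rfl⟩
    have h2 := commutator_stable hB (hS _ hj _ hk)
    simp only [commutator, ← letters_basis b]
    rw [h1, h1, ← neg_sub (B (.single none 1) _), h2, hD _ hj _ hk, ← lie_skew (b j), ← map_neg, ← map_neg, ← map_add,
      ← map_add, ← map_sub, ← map_sub]
    convert map_zero (l ∘ₗ letters b)
    rw [LinearMap.comp_apply]
    congr 2
    abel
  · simp only [commutator, ← letters_basis b]
    rw [h1, h1, h1, ← map_add, ← map_add, ← map_sub, ← map_sub]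
    convert map_zero (l ∘ₗ letters b)
    rw [LinearMap.comp_apply]
    congr 2
    rw [lie_lie, ← lie_skew (b i) ⁅b j, b k⁆, ← lie_skew (b j) ⁅b i, b k⁆]
    abel

theorem exists_lieHom (σ : (Option I →₀ K) →ₗ[K] Module.End K M)
    (hr : ∀ i j, r i j ∨ i = j ∨ r j i)
    (hσ : ∀ x y, Rule r S x y → σ (.single x 1) * σ (.single y 1) -
      σ (.single y 1) * σ (.single x 1) = σ (commutator b D x y)) :
    ∃ ρ : L →ₗ⁅K⁆ Module.End K M, (∀ x, ρ x = σ (letters b x)) ∧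
      ∀ u ∈ Submodule.span K (b '' S), ⁅σ (.single none 1), ρ u⁆ = ρ (D u) := by
  let B : (Option I →₀ K) →ₗ[K] (Option I →₀ K) →ₗ[K] Module.End K M :=
    (LinearMap.mul K (Module.End K M)).compl₁₂ σ σ
  have h : ∀ u v, σ (letters b ⁅u, v⁆) =
      σ (letters b u) * σ (letters b v) - σ (letters b v) * σ (letters b u) :=
    fun u v => (commutator_letters (B := B) (l := σ) hr hσ u v).symm
  exact ⟨{ σ ∘ₗ letters b with map_lie' := fun {u v} => h u v }, fun _ => rfl,
    fun u hu => commutator_stable (B := B) (l := σ) hσ hu⟩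

/-- A basis adapted to a subspace, with a well-order in which the basis of the subspace is an
initial segment. -/
theorem exists_adapted_basis {K : Type u} {L : Type v} [Field K] [AddCommGroup L] [Module K L]
    (s : Submodule K L) :
    ∃ (I : Type v) (b : Module.Basis I K L) (S : Set I) (r : I → I → Prop),
      IsWellOrder I r ∧ (∀ i j, r i j → j ∈ S → i ∈ S) ∧ Submodule.span K (b '' S) = s := by
  obtain ⟨t, hst⟩ := s.exists_isCompl
  let bs := Module.Basis.ofVectorSpace K s
  let bt := Module.Basis.ofVectorSpace K t
  let b := (bs.prod bt).map (s.prodEquivOfIsCompl t hst)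
  refine ⟨_, b, Set.range Sum.inl, Sum.Lex WellOrderingRel WellOrderingRel, inferInstance,
    ?_, ?_⟩
  · rintro _ _ h ⟨j, rfl⟩
    cases h with
    | inl _ => exact ⟨_, rfl⟩
  · have h : b '' Set.range Sum.inl = s.subtype '' Set.range bs := by
      rw [← Set.range_comp, ← Set.range_comp]
      congr 1
      ext i
      simp [b]
    rw [h, Submodule.span_image, bs.span_eq, Submodule.map_top, Submodule.range_subtype]

/-- Every Lie algebra has a faithful representation in which a given derivation from a subalgebra
is induced by an endomorphism. -/
theorem exists_faithful_representation (s : LieSubalgebra K L) (δ : s →ₗ[K] L)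
    (hδ : ∀ x y : s, δ ⁅x, y⁆ = ⁅δ x, (y : L)⁆ + ⁅(x : L), δ y⁆) :
    ∃ (V : Type v) (_ : AddCommGroup V) (_ : Module K V) (ρ : L →ₗ⁅K⁆ Module.End K V)
      (T : Module.End K V), Function.Injective ρ ∧ ∀ x : s, ⁅T, ρ x⁆ = ρ (δ x) := by
  -- Any linear extension will do, since the rules for `t` only use `D` on `s`.
  obtain ⟨D, hD⟩ := LinearMap.exists_extend (p := s.toSubmodule) δ
  have hDs (x : s) : D x = δ x := LinearMap.congr_fun hD x
  obtain ⟨I, b, S, r, hr, hlow, hspan⟩ := exists_adapted_basis s.toSubmodule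
  have htri := fun i j => (trichotomous_of r i j)
  have hov : ResolvesOverlaps (Rule r S) (commutator b D) L := by
    refine resolvesOverlaps htri ?_ ?_ hlow
    · rw [hspan]
      exact fun u hu v hv => s.lie_mem hu hv
    · rw [hspan]
      intro u hu v hv
      have := hδ ⟨u, hu⟩ ⟨v, hv⟩
      rw [← hDs, ← hDs, ← hDs] at this
      exact this
  obtain ⟨N, hN, hcomp⟩ := exists_compatible (Rule r S) (commutator b D)
    (Rule.wellFounded hr.wf S) (Rule.trans (fun i j k => trans_of r (a := i) (b := j) (c := k)) hlow) hov
    -- Only the value `b i` at the one-letter word of `i` matters; all other values are arbitrary.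
    (fun W => (W.headD none).elim 0 b)
  let n : compatible (K := K) (Rule r S) (commutator b D) (M := L) :=
    ⟨N, fun p a b q hab => hcomp _ p a b q hab rfl⟩
  obtain ⟨ρ, hρ, hT⟩ := exists_lieHom (r := r) (S := S) (b := b) (D := D)
    (shiftHom (Rule r S) (commutator b D) (M := L)) htri (fun x y hxy => by
      rw [shiftHom_single, shiftHom_single]
      exact shift_commutator _ _ hxy)
  refine ⟨_, inferInstance, inferInstance, ρ, _, ?_, fun x => (hT x ?_).trans (by rw [hDs])⟩
  · rw [injective_iff_map_eq_zero]
    intro x hx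
    have hsingle (i : I) : N [some i] = b i := by
      refine hN _ fun p a c q _ e => ?_
      have := congrArg List.length e
      simp at this
      omega
    have hins : insert K N [] [] ∘ₗ letters b = LinearMap.id := by
      refine b.ext fun i => ?_
      rw [LinearMap.comp_apply, letters_basis, insert_single]
      exact hsingle i
    have h := shiftHom_apply (Rule r S) (commutator b D) (letters b x) n []
    rw [← hρ, hx] at h
    exact (LinearMap.congr_fun hins x).symm.trans h.symm
  · rw [hspan]
    exact x.2

end LieHNN

/-! ### Passing between Hom-Lie and Lie algebras by twisting -/

namespace HomLieAlgebra

variable {K : Type u} {L : Type v} [Field K] [AddCommGroup L] [Module K L]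

/-- The Lie bracket `β [x, y]` of an involutive multiplicative Hom-Lie algebra. -/
abbrev untwistedLieRing (G : HomLieAlgebra K L) (hmul : G.IsMultiplicative)
    (hinv : G.IsInvolutive) : LieRing L where
  bracket x y := G.twist (G.bracket x y)
  add_lie x y z := by
    change G.twist (G.bracket (x + y) z) = G.twist (G.bracket x z) + G.twist (G.bracket y z)
    simp
  lie_add x y z := by
    change G.twist (G.bracket x (y + z)) = G.twist (G.bracket x y) + G.twist (G.bracket x z)
    simp
  lie_self x := by
    change G.twist (G.bracket x x) = 0
    rw [G.bracket_self, map_zero]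
  leibniz_lie x y z := by
    change G.twist (G.bracket x (G.twist (G.bracket y z))) =
      G.twist (G.bracket (G.twist (G.bracket x y)) z) +
        G.twist (G.bracket y (G.twist (G.bracket x z)))
    have skew : ∀ a b, G.bracket a b = - G.bracket b a := fun a b => by
      have h := G.bracket_self (a + b)
      simp only [map_add, LinearMap.add_apply, G.bracket_self, zero_add, add_zero] at h
      rw [eq_neg_iff_add_eq_zero, add_comm]
      exact h
    have h := G.hom_jacobi x y z
    -- Here `β[x, β[y, z]] = [βx, [y, z]]`, so the Jacobi identity is the Hom-Jacobi identity.
    rw [hmul, hinv, hmul _ z, hinv, hmul y, hinv, skew (G.bracket x y), skew x z, map_neg,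
      ← sub_eq_zero, ← h]
    abel

/-- The bracket of `untwistedLieRing` is bilinear. -/
abbrev untwistedLieAlgebra (G : HomLieAlgebra K L) (hmul : G.IsMultiplicative)
    (hinv : G.IsInvolutive) :
    letI := G.untwistedLieRing hmul hinv
    LieAlgebra K L :=
  letI := G.untwistedLieRing hmul hinv
  { (inferInstance : Module K L) with
    lie_smul := fun k x y => by
      change G.twist (G.bracket x (k • y)) = k • G.twist (G.bracket x y)
      simp }

/-- The square of a Lie algebra as a Hom-Lie algebra, twisted by the interchange of factors. -/
def swapSquare (K : Type u) (A : Type w) [Field K] [LieRing A] [LieAlgebra K A] :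
    HomLieAlgebra K (A × A) where
  bracket := LinearMap.mk₂ K (fun x y => (⁅x.2, y.2⁆, ⁅x.1, y.1⁆)) (by simp) (by simp) (by simp)
    (by simp)
  twist := (LinearEquiv.prodComm K A A).toLinearMap
  bracket_self x := by simp
  hom_jacobi x y z := by simp [lie_jacobi]

theorem swapSquare_isMultiplicative (A : Type w) [LieRing A] [LieAlgebra K A] :
    (swapSquare K A).IsMultiplicative := fun _ _ => rfl

theorem swapSquare_isInvolutive (A : Type w) [LieRing A] [LieAlgebra K A] :
    (swapSquare K A).IsInvolutive := fun _ => rfl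

/-- An involutive multiplicative Hom-Lie algebra embeds into one in which a given `β`-derivation
from a subalgebra is the bracket with an element fixed by the twisting map. -/
theorem exists_embedding_inner (G : HomLieAlgebra K L) (hmul : G.IsMultiplicative)
    (hinv : G.IsInvolutive) (s : G.Subalgebra) (d : G.Derivation s) :
    ∃ (M : Type v) (_ : AddCommGroup M) (_ : Module K M) (H : HomLieAlgebra K M) (f : Hom G H)
      (τ : M), H.IsMultiplicative ∧ H.IsInvolutive ∧ Function.Injective f.toLinearMap ∧
        H.twist τ = τ ∧
        ∀ x : s.toSubmodule, H.bracket τ (f.toLinearMap x) = f.toLinearMap (d.toLinearMap x) := by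
  let _ : LieRing L := G.untwistedLieRing hmul hinv
  let _ : LieAlgebra K L := G.untwistedLieAlgebra hmul hinv
  have lie_eq : ∀ x y : L, ⁅x, y⁆ = G.twist (G.bracket x y) := fun _ _ => rfl
  let s' : LieSubalgebra K L :=
    { s.toSubmodule with lie_mem' := fun hx hy => s.twist_mem (s.bracket_mem hx hy) }
  -- The twist in front matches the one in the new bracket: both sides of the Leibniz rule become
  -- those of the rule for `d`.
  let δ : s' →ₗ[K] L := G.twist ∘ₗ d.toLinearMap
  have hδ : ∀ x y : s', δ ⁅x, y⁆ = ⁅δ x, (y : L)⁆ + ⁅(x : L), δ y⁆ := fun x y => by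
    have h1 := d.map_twist ⟨_, s.bracket_mem x.2 y.2⟩
    have h2 := d.map_bracket x y
    change G.twist (d.toLinearMap ⟨G.twist (G.bracket x y), _⟩) =
      G.twist (G.bracket (G.twist (d.toLinearMap x)) y) +
        G.twist (G.bracket x (G.twist (d.toLinearMap y)))
    rw [h1, hinv, h2, hmul, hmul x, hinv, hinv]
  obtain ⟨V, _, _, ρ, T, hρ, hT⟩ := LieHNN.exists_faithful_representation s' δ hδ
  let f : Hom G (swapSquare K (Module.End K V)) :=
    { toLinearMap := (ρ : L →ₗ[K] Module.End K V).prod ((ρ : L →ₗ[K] Module.End K V) ∘ₗ G.twist)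
      map_bracket := fun x y => by
        change (ρ (G.bracket x y), ρ (G.twist (G.bracket x y))) =
          (⁅ρ (G.twist x), ρ (G.twist y)⁆, ⁅ρ x, ρ y⁆)
        rw [← LieHom.map_lie, ← LieHom.map_lie, lie_eq, lie_eq, ← hmul, hinv]
      map_twist := fun x => by
        change (ρ (G.twist x), ρ (G.twist (G.twist x))) = (ρ (G.twist x), ρ x)
        rw [hinv] }
  refine ⟨Module.End K V × Module.End K V, inferInstance, inferInstance, swapSquare K _, f, (T, T),
    swapSquare_isMultiplicative _, swapSquare_isInvolutive _,
    fun x y h => hρ (congrArg Prod.fst h), rfl, fun x => ?_⟩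
  have h1 : ⁅T, ρ x⁆ = ρ (G.twist (d.toLinearMap x)) := hT x
  have h2 : ⁅T, ρ (G.twist x)⁆ = ρ (d.toLinearMap x) := by
    have h := hT ⟨G.twist x, s.twist_mem x.2⟩
    change ⁅T, ρ (G.twist x)⁆ = ρ (G.twist (d.toLinearMap ⟨G.twist x, _⟩)) at h
    rw [h, d.map_twist, hinv]
  exact Prod.ext h2 h1

end HomLieAlgebra

theorem mainTheorem2 {K : Type u} {L : Type v} [Field K] [AddCommGroup L] [Module K L]
    (G : HomLieAlgebra K L) (hmul : G.IsMultiplicative) (hinv : G.IsInvolutive)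
    (s : G.Subalgebra) (d : G.Derivation s) :
    Function.Injective (HomLieAlgebra.HNNExtension.of G s d).toLinearMap := by
  obtain ⟨M, _, _, H, f, τ, hm, hi, hf, hτ, hd⟩ := G.exists_embedding_inner hmul hinv s d
  obtain ⟨F, ⟨hF, -⟩, -⟩ := HomLieAlgebra.HNNExtension.existsUnique_lift G s d H hm hi f τ hτ hd
  intro x y h
  apply hf
  rw [← hF, ← hF, h]
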